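/- Let $P$ be a triangulated polyhedron in $\mathbb{R}^3$: a triangulated sphere (a finite simplicial complex) with a placement of its vertices in $\mathbb{R}^3$, where self-intersections are allowed. Assume that the edges of $P$ form an isostatic framework, that is, the framework is infinitesimally rigid (every infinitesimal motion preserving the edge lengths to first order is the velocity field of a rigid motion) and has no non-zero self-stress. Let $ABA'$ and $AA'B'$, with $B\neq B'$, be the two faces of $P$ at an edge $AA'$, and assume that the edge lengths satisfy $AB=A'B'$ and $AB'=BA'$. Then there is a line $l$ such that the half-turn (rotation by $180^\circ$) about $l$ swaps the point $A$ with $A'$ and the point $B$ with $B'$. Let $l$ be any such line. Remove from $P$ the edge $AA'$ and its two faces, and let $T$ be the twinned polyhedron obtained by gluing the resulting cap to its image under the half-turn about $l$ along their common boundary $ABA'B'$: the vertices $A,B,A',B'$ of the first copy are identified with the vertices $A',B',A,B$ of the second copy, respectively, and no other vertices are identified. Then $T$ has a single (one-parameter) flex: there are $\varepsilon>0$ and a continuous motion $\gamma(t)$, $t\in(-\varepsilon,\varepsilon)$, of the vertices of $T$, with $\gamma(0)$ the given position, that preserves the lengths of all edges of $T$ and whose positions $\gamma(t)$ are pairwise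 incongruent; and for every $\delta\in(0,\varepsilon]$, every placement of the vertices of $T$ which is sufficiently close to $\gamma(0)$ and has the same edge lengths is the image of $\gamma(t)$ under an orientation-preserving isometry of $\mathbb{R}^3$ for some $t\in(-\delta,\delta)$. -/

import Mathlib

open Filter Topology

noncomputable section

/-- Euclidean three-space. -/
abbrev E3 : Type := EuclideanSpace ℝ (Fin 3)

/-! ### Triangulated polyhedra -/

/-- The edge graph of a family of faces: two distinct vertices are joined when they lie on a
common face (all faces below are triangles). -/
def edgeGraph {V : Type*} (F : Finset (Finset V)) : SimpleGraph V where
  Adj u v := u ≠ v ∧ ∃ f ∈ F, u ∈ f ∧ v ∈ f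
  symm := ⟨fun _ _ h => ⟨h.1.symm, h.2.imp fun _ hf => ⟨hf.1, hf.2.2, hf.2.1⟩⟩⟩
  loopless := ⟨fun _ h => h.1 rfl⟩

/-- The link of a vertex `v`: its vertices are the neighbours of `v`, and two of them are joined
when together with `v` they span a face. -/
def linkGraph {V : Type*} [DecidableEq V] (F : Finset (Finset V)) (v : V) :
    SimpleGraph {u : V // (edgeGraph F).Adj v u} where
  Adj u w := u ≠ w ∧ ({v, u.1, w.1} : Finset V) ∈ F
  symm := ⟨fun u w h => ⟨h.1.symm, by rw [Finset.pair_comm w.1 u.1]; exact h.2⟩⟩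
  loopless := ⟨fun _ h => h.1 rfl⟩

/-- `F` is the set of faces of a triangulation of the two-sphere with vertex set `V`: all faces
are triangles, every edge lies on exactly two faces, the link of every vertex is connected (it is
then a cycle, so that `F` is a closed surface), the surface is connected, and its Euler
characteristic is `2`. -/
structure IsTriangulatedSphere {V : Type*} [Fintype V] [DecidableEq V]
    (F : Finset (Finset V)) : Prop where
  card_face : ∀ f ∈ F, f.card = 3
  two_faces : ∀ u v, (edgeGraph F).Adj u v → {f ∈ F | u ∈ f ∧ v ∈ f}.card = 2
  link_connected : ∀ v, (linkGraph F v).Connected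
  connected : (edgeGraph F).Connected
  euler : (Fintype.card V : ℤ) - ((edgeGraph F).edgeSet.ncard : ℤ) + (F.card : ℤ) = 2

/-! ### Frameworks in three-space

A framework is a graph `G` together with a placement `p : V → E3` of its vertices. -/

/-- An infinitesimal motion assigns a velocity to each vertex, so that the lengths of all edges
are constant to first order. -/
def IsInfinitesimalMotion {V : Type*} (G : SimpleGraph V) (p u : V → E3) : Prop :=
  ∀ i j, G.Adj i j → inner ℝ (p i - p j) (u i - u j) = 0

/-- The velocity field of a rigid motion: a translation plus a skew-symmetric linear map. -/
def IsTrivialMotion {V : Type*} (p u : V → E3) : Prop :=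
  ∃ (S : E3 →ₗ[ℝ] E3) (b : E3), (∀ x, inner ℝ (S x) x = 0) ∧ ∀ i, u i = S (p i) + b

/-- Infinitesimal rigidity: all infinitesimal motions are trivial. -/
def IsInfinitesimallyRigid {V : Type*} (G : SimpleGraph V) (p : V → E3) : Prop :=
  ∀ u : V → E3, IsInfinitesimalMotion G p u → IsTrivialMotion p u

/-- A self-stress: a symmetric weight on the edges that is in equilibrium at every vertex, that
is, a linear dependence between the rows of the rigidity matrix. -/
structure IsSelfStress {V : Type*} [Fintype V] (G : SimpleGraph V) (p : V → E3)
    (ω : V → V → ℝ) : Prop where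
  symm : ∀ i j, ω i j = ω j i
  support : ∀ i j, ¬ G.Adj i j → ω i j = 0
  equilibrium : ∀ i, ∑ j, ω i j • (p i - p j) = 0

/-- An isostatic framework: infinitesimally rigid, and without non-zero self-stress. -/
structure IsIsostatic {V : Type*} [Fintype V] (G : SimpleGraph V) (p : V → E3) : Prop where
  rigid : IsInfinitesimallyRigid G p
  independent : ∀ ω : V → V → ℝ, IsSelfStress G p ω → ω = 0

/-- `q` gives to every edge of `G` the same length as `p`. -/
def SameEdgeLengths {V : Type*} (G : SimpleGraph V) (p q : V → E3) : Prop :=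
  ∀ i j, G.Adj i j → dist (q i) (q j) = dist (p i) (p j)

/-- `q` and `q'` differ by an isometry of the whole space. -/
def IsCongruent {V : Type*} (q q' : V → E3) : Prop :=
  ∃ g : E3 ≃ᵃⁱ[ℝ] E3, ∀ i, q' i = g (q i)

/-- `q` and `q'` differ by a rigid motion, that is, an orientation-preserving isometry (a rotation
followed by a translation). -/
def IsProperlyCongruent {V : Type*} (q q' : V → E3) : Prop :=
  ∃ g : E3 ≃ᵃⁱ[ℝ] E3,
    LinearMap.det (g.linearIsometryEquiv.toLinearEquiv : E3 →ₗ[ℝ] E3) = 1 ∧ ∀ i, q' i = g (q i)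

/-- The framework `(G, p)` has a single flex: there is a continuous one-parameter motion `γ`,
starting at `p`, which preserves all edge lengths and whose positions are pairwise incongruent,
and this is the only flex: the placements close to `p` with the same edge lengths are, up to rigid
motions, the positions `γ t` with `t` close to `0`. (The space of placements with the given edge
lengths is thus, modulo rigid motions and near `p`, an open arc with `p` in its interior.) -/
def HasSingleFlex {V : Type*} (G : SimpleGraph V) (p : V → E3) : Prop :=
  ∃ (ε : ℝ) (γ : ℝ → V → E3), 0 < ε ∧ γ 0 = p ∧ ContinuousOn γ (Set.Ioo (-ε) ε) ∧
    (∀ t ∈ Set.Ioo (-ε) ε, SameEdgeLengths G p (γ t)) ∧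
    (∀ s ∈ Set.Ioo (-ε) ε, ∀ t ∈ Set.Ioo (-ε) ε, IsCongruent (γ s) (γ t) → s = t) ∧
    ∀ δ, 0 < δ → δ ≤ ε → ∀ᶠ q in 𝓝 p, SameEdgeLengths G p q →
      ∃ t ∈ Set.Ioo (-δ) δ, IsProperlyCongruent (γ t) q

/-! ### Twinning -/

/-- The rotation by 180° about the line through `c` with direction `d` (for `d ≠ 0`). In
three-space this is the reflection in that line. -/
def halfTurn (c d : E3) : E3 ≃ᵃⁱ[ℝ] E3 :=
  EuclideanGeometry.reflection (AffineSubspace.mk' c (Submodule.span ℝ {d}))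

/-- The line through `c` with direction `d` is a symmetry line of the quadrilateral `a b a' b'`:
the half-turn about it swaps `a` with `a'` and `b` with `b'`. -/
structure IsSymmetryLine (c d a b a' b' : E3) : Prop where
  direction_ne_zero : d ≠ 0
  swap_a : halfTurn c d a = a'
  swap_a' : halfTurn c d a' = a
  swap_b : halfTurn c d b = b'
  swap_b' : halfTurn c d b' = b

section Twin

variable {V : Type*} [DecidableEq V]

/-- The cap left when the edge `A A'` is removed, with the two faces `A B A'` and `A A' B'`. -/
def capFaces (F : Finset (Finset V)) (A B A' B' : V) : Finset (Finset V) :=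
  F \ {{A, B, A'}, {A, A', B'}}

/-- The vertices of two copies of the cap, glued along `A B A' B'`: all vertices of the first copy,
and the vertices of the second copy that do not lie on the equator. -/
abbrev TwinVertex (A B A' B' : V) : Type _ :=
  V ⊕ {v : V // v ∉ ({A, B, A', B'} : Finset V)}

/-- The vertices of the first copy. -/
def firstCopy (A B A' B' : V) (v : V) : TwinVertex A B A' B' := Sum.inl v

/-- The vertices of the second, rotated copy. Its vertices `A`, `A'`, `B`, `B'` are glued to the
vertices `A'`, `A`, `B'`, `B` of the first copy. -/
def secondCopy (A B A' B' : V) (v : V) : TwinVertex A B A' B' :=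
  if h : v ∈ ({A, B, A', B'} : Finset V) then Sum.inl (Equiv.swap A A' (Equiv.swap B B' v))
  else Sum.inr ⟨v, h⟩

/-- The faces of the twinned polyhedron: those of both copies of the cap. -/
def twinFaces (F : Finset (Finset V)) (A B A' B' : V) : Finset (Finset (TwinVertex A B A' B')) :=
  (capFaces F A B A' B').image (fun f => f.image (firstCopy A B A' B')) ∪
    (capFaces F A B A' B').image (fun f => f.image (secondCopy A B A' B'))

/-- The placement of the twinned polyhedron: the first copy of the cap stays in its place, and the
second one is rotated by the half-turn about the line through `c` with direction `d`. -/
def twinPlacement (p : V → E3) (A B A' B' : V) (c d : E3) : TwinVertex A B A' B' → E3 :=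
  Sum.elim p (fun v => halfTurn c d (p v.1))

end Twin

end

/-! Independence of the edge lengths makes the rigidity map surjective, so by the inverse function
theorem the squared length of `A A'` can be varied alone, all other edge lengths being kept
(`exists_curve_of_surjective`). This gives a curve of placements of the cap, parametrized by the
change in that squared length. Along it the equations AB = A'B' and AB' = BA' persist, so the
quadrilateral keeps a symmetry line, which can be chosen continuously
(`exists_continuous_symmetryLine`). Rotating the moving cap about the moving line produces a second
copy that still fits on the equator, and the twin flexes.

For uniqueness, consider a nearby placement of the twin with the same edge lengths. Its two copies
of the cap share the length of `A A'`, so by local rigidity each is a rigid image of the same cap on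
the curve (`eventually_isProperlyCongruent`). Both rigid motions, one composed with the half-turn of
the moved cap and the other followed by the original half-turn, agree on the nondegenerate triangle
`A B A'`. Being orientation-preserving they coincide (`IsProper.eq_of_apply_eq`), so one rigid
motion carries the whole twin on the curve to the given placement. -/

noncomputable section

/-! ### The cross product and orientation-preserving isometries -/

/-- The cross product of Euclidean three-space. -/
def cross (x y : E3) : E3 :=
  !₂[x 1 * y 2 - x 2 * y 1, x 2 * y 0 - x 0 * y 2, x 0 * y 1 - x 1 * y 0]

theorem inner_eq_coordinates (x y : E3) : inner ℝ x y = x 0 * y 0 + x 1 * y 1 + x 2 * y 2 := by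
  simp [PiLp.inner_apply, Fin.sum_univ_three, mul_comm]

theorem continuous_cross {X : Type*} [TopologicalSpace X] {f g : X → E3} (hf : Continuous f)
    (hg : Continuous g) : Continuous fun x => cross (f x) (g x) := by
  unfold cross
  refine (PiLp.continuous_toLp 2 _).comp (continuous_pi fun i => ?_)
  fin_cases i <;> simp <;> fun_prop

theorem inner_cross_left (x y : E3) : inner ℝ (cross x y) x = 0 := by
  simp [inner_eq_coordinates, cross]; ring

theorem inner_cross_right (x y : E3) : inner ℝ (cross x y) y = 0 := by
  simp [inner_eq_coordinates, cross]; ring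

/-- A vector orthogonal to `x` and `y` is parallel to their cross product. -/
theorem smul_eq_smul_cross {x y w : E3} (hx : inner ℝ w x = 0) (hy : inner ℝ w y = 0) :
    inner ℝ (cross x y) (cross x y) • w = inner ℝ (cross x y) w • cross x y := by
  rw [inner_eq_coordinates] at hx hy
  rw [inner_eq_coordinates, inner_eq_coordinates]
  obtain ⟨n, hn⟩ : ∃ n, n = cross x y := ⟨_, rfl⟩
  have h0 : n 0 = x 1 * y 2 - x 2 * y 1 := by simp [hn, cross]
  have h1 : n 1 = x 2 * y 0 - x 0 * y 2 := by simp [hn, cross]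
  have h2 : n 2 = x 0 * y 1 - x 1 * y 0 := by simp [hn, cross]
  rw [← hn]
  ext i
  fin_cases i <;> simp [h0, h1, h2]
  · linear_combination ((x 2 * y 0 - x 0 * y 2) * x 2 - (x 0 * y 1 - x 1 * y 0) * x 1) * hy -
      ((x 2 * y 0 - x 0 * y 2) * y 2 - (x 0 * y 1 - x 1 * y 0) * y 1) * hx
  · linear_combination ((x 0 * y 1 - x 1 * y 0) * x 0 - (x 1 * y 2 - x 2 * y 1) * x 2) * hy -
      ((x 0 * y 1 - x 1 * y 0) * y 0 - (x 1 * y 2 - x 2 * y 1) * y 2) * hx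
  · linear_combination ((x 1 * y 2 - x 2 * y 1) * x 1 - (x 2 * y 0 - x 0 * y 2) * x 0) * hy -
      ((x 1 * y 2 - x 2 * y 1) * y 1 - (x 2 * y 0 - x 0 * y 2) * y 0) * hx

theorem exists_eq_smul_of_cross_eq_zero {w z : E3} (hw : w ≠ 0) (h : cross w z = 0) :
    ∃ k : ℝ, z = k • w := by
  have h0 : w 1 * z 2 - w 2 * z 1 = 0 := by simpa [cross] using congrArg (fun v : E3 => v 0) h
  have h1 : w 2 * z 0 - w 0 * z 2 = 0 := by simpa [cross] using congrArg (fun v : E3 => v 1) h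
  have h2 : w 0 * z 1 - w 1 * z 0 = 0 := by simpa [cross] using congrArg (fun v : E3 => v 2) h
  refine ⟨(inner ℝ w w)⁻¹ * inner ℝ w z, ?_⟩
  rw [mul_smul, eq_inv_smul_iff₀ (inner_self_ne_zero.2 hw), inner_eq_coordinates,
    inner_eq_coordinates]
  ext i
  fin_cases i <;> simp
  · linear_combination w 2 * h1 - w 1 * h2
  · linear_combination w 0 * h2 - w 2 * h0
  · linear_combination w 1 * h0 - w 0 * h1

theorem inner_cross_eq_det (x y z : E3) : inner ℝ (cross x y) z =
    (EuclideanSpace.basisFun (Fin 3) ℝ).toBasis.det ![x, y, z] := by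
  rw [Module.Basis.det_apply, Matrix.det_fin_three]
  simp [inner_eq_coordinates, cross, Module.Basis.toMatrix_apply]
  ring

theorem inner_cross_map (φ : E3 →ₗ[ℝ] E3) (x y z : E3) :
    inner ℝ (cross (φ x) (φ y)) (φ z) = LinearMap.det φ * inner ℝ (cross x y) z := by
  rw [inner_cross_eq_det, inner_cross_eq_det, ← Module.Basis.det_comp]
  congr 1
  ext i
  fin_cases i <;> rfl

/-- An isometry is proper if it preserves the orientation. -/
def IsProper (g : E3 ≃ᵃⁱ[ℝ] E3) : Prop :=
  LinearMap.det (g.linearIsometryEquiv.toLinearEquiv : E3 →ₗ[ℝ] E3) = 1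

theorem IsProper.trans {g h : E3 ≃ᵃⁱ[ℝ] E3} (hg : IsProper g) (hh : IsProper h) :
    IsProper (g.trans h) := by
  unfold IsProper at *
  have : ((g.trans h).linearIsometryEquiv.toLinearEquiv : E3 →ₗ[ℝ] E3) =
    (h.linearIsometryEquiv.toLinearEquiv : E3 →ₗ[ℝ] E3) ∘ₗ
      (g.linearIsometryEquiv.toLinearEquiv : E3 →ₗ[ℝ] E3) := rfl
  rw [this, LinearMap.det_comp, hg, hh, one_mul]

/-- The vector `g x - h x` is orthogonal to the images of both sides of the triangle, hence parallel
to the normal of the image triangle. Its component along that normal vanishes too, since proper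
isometries preserve triple products. -/
theorem IsProper.eq_of_apply_eq {g h : E3 ≃ᵃⁱ[ℝ] E3} (hg : IsProper g) (hh : IsProper h)
    {a b c : E3} (habc : cross (b - a) (c - a) ≠ 0) (ha : g a = h a) (hb : g b = h b)
    (hc : g c = h c) : g = h := by
  have key : ∀ (g : E3 ≃ᵃⁱ[ℝ] E3) (x y : E3), g x - g y = g.linearIsometryEquiv (x - y) :=
    fun g x y => (g.map_vsub x y).symm
  ext1 x
  have hxy : ∀ y, g y = h y → inner ℝ (g x - h x) (g.linearIsometryEquiv (y - a)) = 0 := by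
    intro y hy
    have e : g x - h x = g.linearIsometryEquiv (x - a) - h.linearIsometryEquiv (x - a) := by
      rw [← key, ← key, ha]; abel
    have e' : g.linearIsometryEquiv (y - a) = h.linearIsometryEquiv (y - a) := by
      rw [← key, ← key, ha, hy]
    rw [e, inner_sub_left, LinearIsometryEquiv.inner_map_map, e',
      LinearIsometryEquiv.inner_map_map, sub_self]
  have eb : g.linearIsometryEquiv (b - a) = h.linearIsometryEquiv (b - a) := by
    rw [← key, ← key, ha, hb]
  have ec : g.linearIsometryEquiv (c - a) = h.linearIsometryEquiv (c - a) := by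
    rw [← key, ← key, ha, hc]
  have hdet := smul_eq_smul_cross (hxy b hb) (hxy c hc)
  have h1 := inner_cross_map (g.linearIsometryEquiv.toLinearEquiv : E3 →ₗ[ℝ] E3)
    (b - a) (c - a) (x - a)
  have h2 := inner_cross_map (h.linearIsometryEquiv.toLinearEquiv : E3 →ₗ[ℝ] E3)
    (b - a) (c - a) (x - a)
  have h3 := inner_cross_map (g.linearIsometryEquiv.toLinearEquiv : E3 →ₗ[ℝ] E3)
    (b - a) (c - a) (cross (b - a) (c - a))
  unfold IsProper at hg hh
  rw [hg, one_mul] at h1 h3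
  rw [hh, one_mul] at h2
  simp only [LinearEquiv.coe_coe, LinearIsometryEquiv.coe_toLinearEquiv] at h1 h2 h3
  rw [← eb, ← ec, ← key h x a, ← ha] at h2
  rw [← key g x a] at h1
  have h4 : inner ℝ (cross (g.linearIsometryEquiv (b - a)) (g.linearIsometryEquiv (c - a)))
      (g x - h x) = 0 := by
    rw [← sub_sub_sub_cancel_right (g x) (h x) (g a), inner_sub_right, h1, h2, sub_self]
  rw [h4, zero_smul, smul_eq_zero] at hdet
  rcases hdet with hdet | hdet
  · rw [inner_self_eq_zero] at hdet
    rw [hdet, inner_zero_left] at h3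
    exact absurd (inner_self_eq_zero.1 h3.symm) habc
  · exact sub_eq_zero.1 hdet

/-! ### Half-turns -/

theorem halfTurn_apply (c d x : E3) :
    halfTurn c d x = (2 : ℝ) • (c + (inner ℝ d (x - c) / ‖d‖ ^ 2) • d) - x := by
  have hc : c ∈ AffineSubspace.mk' c (Submodule.span ℝ {d}) := AffineSubspace.self_mem_mk' _ _
  have hK : ∀ K : Submodule ℝ E3, K = Submodule.span ℝ {d} → K.reflection (x - c) + c =
      (2 : ℝ) • (c + (inner ℝ d (x - c) / ‖d‖ ^ 2) • d) - x := by
    rintro K rfl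
    rw [Submodule.reflection_singleton_apply, RCLike.ofReal_real_eq_id, id]
    module
  exact (EuclideanGeometry.reflection_apply_of_mem _ x hc).trans
    (hK _ (AffineSubspace.direction_mk' _ _))

/-- The half-turn acts as -1 on the plane orthogonal to `d`, so its determinant is (-1)² = 1. -/
theorem isProper_halfTurn {c d : E3} (hd : d ≠ 0) : IsProper (halfTurn c d) := by
  have hK : ∀ K : Submodule ℝ E3, K = Submodule.span ℝ {d} →
      LinearMap.det K.reflection.toLinearMap = 1 := by
    rintro K rfl
    have : Fact (Module.finrank ℝ E3 = 2 + 1) := ⟨by simp⟩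
    rw [Submodule.det_reflection, Submodule.finrank_orthogonal_span_singleton (n := 2) hd]
    norm_num
  exact hK _ (AffineSubspace.direction_mk' c _)

theorem halfTurn_halfTurn (c d x : E3) : halfTurn c d (halfTurn c d x) = x := by
  exact EuclideanGeometry.reflection_reflection _ _

/-- Needed because the prescribed line may differ from the one in the continuous family: only the
half-turn matters for the twin. -/
theorem halfTurn_eq_of_isSymmetryLine {c d c' d' a b a' b' : E3}
    (h : IsSymmetryLine c d a b a' b') (h' : IsSymmetryLine c' d' a b a' b')
    (hne : cross (b - a) (a' - a) ≠ 0) : halfTurn c d = halfTurn c' d' :=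
  (isProper_halfTurn h.direction_ne_zero).eq_of_apply_eq
    (isProper_halfTurn h'.direction_ne_zero) hne (h.swap_a.trans h'.swap_a.symm)
    (h.swap_b.trans h'.swap_b.symm) (h.swap_a'.trans h'.swap_a'.symm)

/-- If `d ≠ 0` is orthogonal to `a - a'` and `b - b'` and parallel to the line joining the midpoints
of these segments, then it is the direction of a symmetry line. -/
theorem isSymmetryLine_of_inner_eq_zero {d a b a' b' : E3} (hd : d ≠ 0)
    (ha : inner ℝ d (a - a') = 0) (hb : inner ℝ d (b - b') = 0) (k : ℝ)
    (hk : (b + b') - (a + a') = k • d) :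
    IsSymmetryLine ((2⁻¹ : ℝ) • (a + a')) d a b a' b' := by
  have hd' : ‖d‖ ^ 2 ≠ 0 := by simpa using hd
  have hA : halfTurn ((2⁻¹ : ℝ) • (a + a')) d a = a' := by
    have : a - (2⁻¹ : ℝ) • (a + a') = (2⁻¹ : ℝ) • (a - a') := by module
    rw [halfTurn_apply, this, inner_smul_right, ha]
    module
  have hB : halfTurn ((2⁻¹ : ℝ) • (a + a')) d b = b' := by
    have h1 : b - (2⁻¹ : ℝ) • (a + a') = (2⁻¹ : ℝ) • (b - b') + (2⁻¹ * k : ℝ) • d := by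
      rw [mul_smul, ← hk]; module
    have h2 : b' = k • d + (a + a') - b := by rw [← hk]; abel
    rw [halfTurn_apply, h1, inner_add_right, inner_smul_right, inner_smul_right, hb,
      real_inner_self_eq_norm_sq, mul_zero, zero_add, mul_div_cancel_right₀ _ hd', h2]
    module
  refine ⟨hd, hA, ?_, hB, ?_⟩
  · have := halfTurn_halfTurn ((2⁻¹ : ℝ) • (a + a')) d a
    rwa [hA] at this
  · have := halfTurn_halfTurn ((2⁻¹ : ℝ) • (a + a')) d b
    rwa [hB] at this

/-- The sum of the two equations between squared lengths gives the first orthogonality, their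
difference the second. -/
theorem inner_midpoints_sub {a b a' b' : E3} (hab : dist a b = dist a' b')
    (hab' : dist a b' = dist b a') :
    inner ℝ ((b + b') - (a + a')) (a - a') = 0 ∧ inner ℝ ((b + b') - (a + a')) (b - b') = 0 := by
  rw [dist_eq_norm, dist_eq_norm, ← sq_eq_sq₀ (norm_nonneg _) (norm_nonneg _),
    ← real_inner_self_eq_norm_sq, ← real_inner_self_eq_norm_sq] at hab hab'
  simp only [inner_eq_coordinates, PiLp.add_apply, PiLp.sub_apply] at *
  constructor <;> linarith

/-- Near a quadrilateral `a b a' b'` with three vertices in general position, a symmetry line can be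
chosen continuously. -/
theorem exists_continuous_symmetryLine {a₀ b₀ a₀' b₀' : E3}
    (hne : cross (b₀ - a₀) (a₀' - a₀) ≠ 0) :
    ∃ D : E3 → E3 → E3 → E3 → E3, Continuous (fun x : E3 × E3 × E3 × E3 =>
        D x.1 x.2.1 x.2.2.1 x.2.2.2) ∧
      (dist a₀ b₀ = dist a₀' b₀' → dist a₀ b₀' = dist b₀ a₀' → D a₀ b₀ a₀' b₀' ≠ 0) ∧
      ∀ a b a' b', dist a b = dist a' b' → dist a b' = dist b a' → D a b a' b' ≠ 0 →
        IsSymmetryLine ((2⁻¹ : ℝ) • (a + a')) (D a b a' b') a b a' b' := by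
  -- The direction can be the join of the midpoints of the diagonals or the cross product of the
  -- diagonals. Either may vanish, but not both: if the midpoints coincide, the cross product is
  -- twice the normal of the triangle. A choice that is nonzero at the base quadrilateral is used
  -- throughout.
  by_cases h : cross (a₀ - a₀') (b₀ - b₀') = 0
  · refine ⟨fun a b a' b' => (b + b') - (a + a'), by fun_prop, fun h1 h2 h3 => hne ?_,
      fun a b a' b' h1 h2 h3 => ?_⟩
    · have hb : b₀ - b₀' = (2 : ℝ) • (b₀ - a₀) - (a₀' - a₀) := by
        have : b₀' = a₀ + a₀' - b₀ := by
          rw [← sub_eq_zero.1 h3]; abel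
        rw [this]; module
      rw [hb] at h
      have e : cross (a₀ - a₀') ((2 : ℝ) • (b₀ - a₀) - (a₀' - a₀)) =
          (2 : ℝ) • cross (b₀ - a₀) (a₀' - a₀) := by
        ext i
        fin_cases i <;> simp [cross] <;> ring
      rw [e] at h
      simpa using h
    · obtain ⟨h4, h5⟩ := inner_midpoints_sub h1 h2
      exact isSymmetryLine_of_inner_eq_zero h3 h4 h5 1 (one_smul _ _).symm
  · refine ⟨fun a b a' b' => cross (a - a') (b - b'), continuous_cross (by fun_prop) (by fun_prop),
      fun _ _ => h, fun a b a' b' h1 h2 h3 => ?_⟩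
    obtain ⟨h4, h5⟩ := inner_midpoints_sub h1 h2
    refine isSymmetryLine_of_inner_eq_zero h3 (inner_cross_left _ _) (inner_cross_right _ _)
      ((inner ℝ (cross (a - a') (b - b')) (cross (a - a') (b - b')))⁻¹ *
        inner ℝ (cross (a - a') (b - b')) ((b + b') - (a + a'))) ?_
    rw [mul_smul, ← smul_eq_smul_cross h4 h5, inv_smul_smul₀]
    simpa using h3

/-! ### The Cayley transform -/

/-- The adjoint of `1 + S` is `1 - S`. This is what makes the Cayley transform
orientation-preserving. -/
theorem det_one_add_eq_det_one_sub {S : E3 →ₗ[ℝ] E3} (hS : ∀ x, inner ℝ (S x) x = 0) :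
    LinearMap.det (1 + S) = LinearMap.det (1 - S) := by
  have hadj : (1 - S : E3 →ₗ[ℝ] E3) = LinearMap.adjoint (1 + S) := by
    rw [LinearMap.eq_adjoint_iff]
    intro x y
    have h := hS (x + y)
    simp only [map_add, inner_add_left, inner_add_right, hS] at h
    have h' := real_inner_comm x (S y)
    simp only [LinearMap.sub_apply, LinearMap.add_apply, Module.End.one_apply, inner_sub_left,
      inner_add_right]
    linarith
  rw [hadj, ← LinearMap.det_toMatrix (EuclideanSpace.basisFun (Fin 3) ℝ).toBasis,
    ← LinearMap.det_toMatrix (EuclideanSpace.basisFun (Fin 3) ℝ).toBasis,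
    LinearMap.toMatrix_adjoint, Matrix.det_conjTranspose, star_trivial]

/-- For a skew-symmetric map `S`, the points `x + S x + b` and `x - S x - b` differ by a proper
isometry which does not depend on `x`. -/
theorem exists_isProper_cayley {S : E3 →ₗ[ℝ] E3} (hS : ∀ x, inner ℝ (S x) x = 0) (b : E3) :
    ∃ g, IsProper g ∧ ∀ x, x + S x + b = g (x - S x - b) := by
  have hn : ∀ x, ‖(1 + S) x‖ = ‖(1 - S) x‖ := fun x => by
    rw [← sq_eq_sq₀ (norm_nonneg _) (norm_nonneg _)]
    have h := hS x
    rw [real_inner_comm] at h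
    simp [norm_add_sq_real, norm_sub_sq_real, h]
  have hker : LinearMap.ker (1 - S) = ⊥ := by
    rw [LinearMap.ker_eq_bot']
    intro x hx
    have : inner ℝ ((1 - S) x) x = 0 := by rw [hx, inner_zero_left]
    simpa [inner_sub_left, hS] using this
  let P : E3 ≃ₗ[ℝ] E3 := LinearEquiv.ofInjectiveEndo (1 - S) (LinearMap.ker_eq_bot.1 hker)
  have hP : (P : E3 →ₗ[ℝ] E3) = 1 - S := by ext1 x; rfl
  have hP' : ∀ x, P x = x - S x := fun x => rfl
  let O : E3 ≃ₗᵢ[ℝ] E3 := LinearIsometry.toLinearIsometryEquiv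
    ⟨(1 + S) ∘ₗ (P.symm : E3 →ₗ[ℝ] E3), fun x => by
      simp only [LinearMap.comp_apply]
      rw [hn, ← hP]; simp⟩ rfl
  have hO' : (O.toLinearEquiv : E3 →ₗ[ℝ] E3) = (1 + S) ∘ₗ (P.symm : E3 →ₗ[ℝ] E3) := rfl
  have hO : ∀ x, O (x - S x) = x + S x := fun x => by
    rw [← hP']
    change (1 + S) (P.symm (P x)) = _
    simp
  -- The linear part is `O` = (1 + S)(1 - S)⁻¹. The translation cancels the `-O b` coming from `O (x
  -- - S x - b)` and adds `b`.
  refine ⟨O.toAffineIsometryEquiv.trans (AffineIsometryEquiv.constVAdd ℝ E3 (O b + b)), ?_, ?_⟩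
  · change LinearMap.det (O.toLinearEquiv : E3 →ₗ[ℝ] E3) = 1
    rw [hO', LinearMap.det_comp, det_one_add_eq_det_one_sub hS, ← hP, ← LinearMap.det_comp]
    simp
  · intro x
    simp [map_sub, ← hO]
    abel

/-! ### Rigidity near an infinitesimally rigid placement -/

/-- The rank of a linear map is a lower semicontinuous function of a parameter. -/
theorem eventually_finrank_range_le {X Z W : Type*} [TopologicalSpace X] [AddCommGroup Z]
    [Module ℝ Z] [NormedAddCommGroup W] [NormedSpace ℝ W] [FiniteDimensional ℝ W]
    (L : X → Z →ₗ[ℝ] W) (hL : ∀ z, Continuous fun x => L x z) (p : X) :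
    ∀ᶠ m in 𝓝 p, Module.finrank ℝ (LinearMap.range (L p)) ≤
      Module.finrank ℝ (LinearMap.range (L m)) := by
  have b := Module.finBasis ℝ (LinearMap.range (L p))
  choose z hz using fun i => (b i).2
  have hli : LinearIndependent ℝ fun i => L p (z i) := by
    simp only [hz]
    exact b.linearIndependent.map' (LinearMap.range (L p)).subtype (Submodule.ker_subtype _)
  have hcont : Continuous fun m => fun i => L m (z i) := continuous_pi fun i => hL (z i)
  -- Linear independence of a finite family is an open condition.
  filter_upwards [hcont.continuousAt.eventually hli.eventually] with m hm
  have hm' : LinearIndependent ℝ fun i =>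
      (⟨L m (z i), LinearMap.mem_range_self _ _⟩ : LinearMap.range (L m)) :=
    LinearIndependent.of_comp (LinearMap.range (L m)).subtype hm
  simpa using hm'.fintype_card_le_finrank

section Rigidity

variable {V : Type*} (G : SimpleGraph V)

/-- The skew-symmetric linear maps of Euclidean three-space. -/
def skewMaps : Submodule ℝ (E3 →ₗ[ℝ] E3) where
  carrier := {S | ∀ x, inner ℝ (S x) x = 0}
  zero_mem' := fun x => by simp
  add_mem' := fun hS hT x => by simp [inner_add_left, hS x, hT x]
  smul_mem' := fun c S hS x => by simp [real_inner_smul_left, hS x]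

/-- The velocity fields of rigid motions, as a linear map. -/
def trivialMotion (p : V → E3) : skewMaps × E3 →ₗ[ℝ] V → E3 where
  toFun z i := z.1.1 (p i) + z.2
  map_add' z w := by
    ext1 i
    simp only [Prod.fst_add, Prod.snd_add, Submodule.coe_add, LinearMap.add_apply, Pi.add_apply]
    abel
  map_smul' c z := by
    ext1 i
    simp

theorem mem_range_trivialMotion {p u : V → E3} :
    u ∈ LinearMap.range (trivialMotion p) ↔ IsTrivialMotion p u := by
  constructor
  · rintro ⟨⟨S, b⟩, rfl⟩
    exact ⟨S.1, b, S.2, fun i => rfl⟩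
  · rintro ⟨S, b, hS, hu⟩
    exact ⟨(⟨S, hS⟩, b), funext fun i => (hu i).symm⟩

/-- The symmetric functions on pairs of vertices that vanish off the edges of `G`. -/
def edgeWeights : Submodule ℝ (EuclideanSpace ℝ (V × V)) where
  carrier := {y | (∀ i j, y (i, j) = y (j, i)) ∧ ∀ i j, ¬ G.Adj i j → y (i, j) = 0}
  zero_mem' := ⟨fun i j => rfl, fun i j _ => rfl⟩
  add_mem' := fun hx hy => ⟨fun i j => by simp [hx.1 i j, hy.1 i j],
    fun i j h => by simp [hx.2 i j h, hy.2 i j h]⟩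
  smul_mem' := fun c x hx => ⟨fun i j => by simp [hx.1 i j],
    fun i j h => by simp [hx.2 i j h]⟩

open Classical in
/-- The bilinear map whose value at `(p, u)` is half of the derivative at `p`, in the direction `u`,
of the squared edge lengths. -/
def rigidityForm : (V → E3) →ₗ[ℝ] (V → E3) →ₗ[ℝ] edgeWeights G :=
  LinearMap.mk₂ ℝ (fun p u => ⟨WithLp.toLp 2 fun e =>
      if G.Adj e.1 e.2 then inner ℝ (p e.1 - p e.2) (u e.1 - u e.2) else 0,
      fun i j => by
        simp only [G.adj_comm i j]
        rw [← neg_sub (p i), ← neg_sub (u i), inner_neg_neg],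
      fun i j h => by simp [h]⟩)
    (fun p q u => by
      ext ⟨i, j⟩
      by_cases h : G.Adj i j <;> simp [h]
      rw [add_sub_add_comm, inner_add_left])
    (fun c p u => by
      ext ⟨i, j⟩
      by_cases h : G.Adj i j <;> simp [h]
      rw [← smul_sub, real_inner_smul_left])
    (fun p u v => by
      ext ⟨i, j⟩
      by_cases h : G.Adj i j <;> simp [h]
      rw [add_sub_add_comm, inner_add_right])
    (fun c p u => by
      ext ⟨i, j⟩
      by_cases h : G.Adj i j <;> simp [h]
      rw [← smul_sub, real_inner_smul_right])

variable {G}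

theorem rigidityForm_apply_of_adj (p u : V → E3) {i j : V} (h : G.Adj i j) :
    (rigidityForm G p u).1 (i, j) = inner ℝ (p i - p j) (u i - u j) := by
  simp [rigidityForm, h]

theorem edgeWeights_ext {x y : edgeWeights G} (h : ∀ i j, G.Adj i j → x.1 (i, j) = y.1 (i, j)) :
    x = y := by
  ext ⟨i, j⟩
  by_cases hij : G.Adj i j
  · exact h i j hij
  · rw [x.2.2 i j hij, y.2.2 i j hij]

theorem rigidityForm_eq_zero_iff {p u : V → E3} :
    rigidityForm G p u = 0 ↔ IsInfinitesimalMotion G p u := by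
  constructor
  · intro h i j hij
    rw [← rigidityForm_apply_of_adj p u hij, h]
    rfl
  · intro h
    refine edgeWeights_ext fun i j hij => ?_
    rw [rigidityForm_apply_of_adj p u hij, h i j hij]
    rfl

theorem IsTrivialMotion.isInfinitesimalMotion {p u : V → E3} (h : IsTrivialMotion p u) :
    IsInfinitesimalMotion G p u := by
  obtain ⟨S, b, hS, hu⟩ := h
  intro i j _
  rw [hu, hu, add_sub_add_right_eq_sub, ← map_sub, real_inner_comm, hS]

/-- Two placements with equal edge lengths whose average is infinitesimally rigid differ by a
rigid motion. -/
theorem IsInfinitesimallyRigid.isProperlyCongruent {q q' : V → E3}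
    (h : IsInfinitesimallyRigid G ((2⁻¹ : ℝ) • (q + q'))) (hqq' : SameEdgeLengths G q q') :
    IsProperlyCongruent q q' := by
  -- Since |x|² - |y|² = ⟨x + y, x - y⟩, equal edge lengths say that the half-difference is an
  -- infinitesimal motion of the average m. It is therefore S m + b, so that q' = m + S m + b and q
  -- = m - S m - b, as in the Cayley transform.
  obtain ⟨S, b, hS, hu⟩ := h ((2⁻¹ : ℝ) • (q' - q)) fun i j hij => by
    have hd := hqq' i j hij
    rw [dist_eq_norm, dist_eq_norm, ← real_inner_add_sub_eq_zero_iff] at hd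
    have e1 : ((2⁻¹ : ℝ) • (q + q')) i - ((2⁻¹ : ℝ) • (q + q')) j =
        (2⁻¹ : ℝ) • ((q' i - q' j) + (q i - q j)) := by
      simp only [Pi.smul_apply, Pi.add_apply]; module
    have e2 : ((2⁻¹ : ℝ) • (q' - q)) i - ((2⁻¹ : ℝ) • (q' - q)) j =
        (2⁻¹ : ℝ) • ((q' i - q' j) - (q i - q j)) := by
      simp only [Pi.smul_apply, Pi.sub_apply]; module
    rw [e1, e2, real_inner_smul_left, real_inner_smul_right, hd, mul_zero, mul_zero]
  obtain ⟨g, hg, hgx⟩ := exists_isProper_cayley hS b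
  refine ⟨g, hg, fun i => ?_⟩
  have hi := hu i
  have := hgx (((2⁻¹ : ℝ) • (q + q')) i)
  rw [add_assoc, ← hi, sub_sub, ← hi] at this
  convert this using 1
  · simp only [Pi.smul_apply, Pi.add_apply, Pi.sub_apply]; module
  · congr 1
    simp only [Pi.smul_apply, Pi.add_apply, Pi.sub_apply]; module

/-- The indicator function of an edge. -/
def edgeIndicator [DecidableEq V] {a b : V} (hab : G.Adj a b) : edgeWeights G :=
  ⟨WithLp.toLp 2 fun x => if s(x.1, x.2) = s(a, b) then 1 else 0,
    fun i j => by simp only [Sym2.eq_swap],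
    fun i j h => by
      have : s(i, j) ≠ s(a, b) := fun h' => h ((G.mem_edgeSet).1 (h' ▸ (G.mem_edgeSet).2 hab))
      simp [this]⟩

theorem edgeIndicator_apply [DecidableEq V] {a b : V} (hab : G.Adj a b) (i j : V) :
    (edgeIndicator hab).1 (i, j) = if s(i, j) = s(a, b) then 1 else 0 := rfl

/-- A triangle of an independent framework is not degenerate. -/
theorem cross_ne_zero_of_surjective [DecidableEq V] {p : V → E3}
    (hp : Function.Surjective (rigidityForm G p)) {a b c : V} (hab : G.Adj a b) (hac : G.Adj a c)
    (hbc : G.Adj b c) : cross (p b - p a) (p c - p a) ≠ 0 := by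
  have hne : ∀ {i j : V}, G.Adj i j → p i ≠ p j := fun {i j} hij h => by
    obtain ⟨u, hu⟩ := hp (edgeIndicator hij)
    have h' := congrArg (fun y : edgeWeights G => y.1 (i, j)) hu
    simp [rigidityForm_apply_of_adj _ _ hij, edgeIndicator_apply, h] at h'
  intro h
  have hw : p b - p a ≠ 0 := sub_ne_zero.2 (hne hab).symm
  obtain ⟨k, hk⟩ := exists_eq_smul_of_cross_eq_zero hw h
  -- On a line, stretching `a b` to first order while keeping `a c` and `b c` is impossible: all
  -- three conditions involve only the velocity components along that line.
  obtain ⟨u, hu⟩ := hp (edgeIndicator hab)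
  have h1 := congrArg (fun y : edgeWeights G => y.1 (a, b)) hu
  have h2 := congrArg (fun y : edgeWeights G => y.1 (a, c)) hu
  have h3 := congrArg (fun y : edgeWeights G => y.1 (b, c)) hu
  have e1 : p a - p b = -(p b - p a) := by abel
  have e2 : p a - p c = -(p c - p a) := by abel
  have e3 : p b - p c = (p b - p a) - (p c - p a) := by abel
  simp only [rigidityForm_apply_of_adj _ _ hab, rigidityForm_apply_of_adj _ _ hac,
    rigidityForm_apply_of_adj _ _ hbc, edgeIndicator_apply, e1, e2, e3] at h1 h2 h3
  rw [if_neg (by simp [hbc.ne', hab.ne])] at h2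
  rw [if_neg (by simp [hab.ne', hac.ne'])] at h3
  rw [if_pos trivial] at h1
  rw [hk] at h2 h3
  have hk0 : k ≠ 0 := fun h0 => hne hac (sub_eq_zero.1 (by rw [hk, h0, zero_smul])).symm
  have hk1 : 1 - k ≠ 0 := fun h0 => hne hbc (by
    rw [← sub_eq_zero, e3, hk]
    nth_rw 1 [← one_smul ℝ (p b - p a)]
    rw [← sub_smul, h0, zero_smul])
  have e4 : p b - p a - k • (p b - p a) = (1 - k) • (p b - p a) := by module
  rw [inner_neg_left, real_inner_smul_left, neg_eq_zero, mul_eq_zero, or_iff_right hk0] at h2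
  rw [e4, real_inner_smul_left, mul_eq_zero, or_iff_right hk1] at h3
  rw [inner_neg_left] at h1
  simp only [inner_sub_right] at h1 h2 h3
  linarith

variable [Fintype V]

/-- Near `p` neither the rank of the rigidity map nor the dimension of the space of trivial motions
can drop. Hence the inclusion of trivial motions in the kernel, an equality at `p`, remains one. -/
theorem eventually_isInfinitesimallyRigid {p : V → E3} (hp : IsInfinitesimallyRigid G p) :
    ∀ᶠ m in 𝓝 p, IsInfinitesimallyRigid G m := by
  have h1 := eventually_finrank_range_le (fun m : V → E3 => rigidityForm G m)
    (fun z => ((rigidityForm G).flip z).continuous_of_finiteDimensional) p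
  have h2 := eventually_finrank_range_le (fun m : V → E3 => trivialMotion m)
    (fun z => continuous_pi fun i => ((z.1.1.continuous_of_finiteDimensional).comp
      (continuous_apply i)).add continuous_const) p
  have hle : ∀ m : V → E3,
      LinearMap.range (trivialMotion m) ≤ LinearMap.ker (rigidityForm G m) := fun m u hu =>
    LinearMap.mem_ker.2 (rigidityForm_eq_zero_iff.2
      (mem_range_trivialMotion.1 hu).isInfinitesimalMotion)
  have hp' : LinearMap.range (trivialMotion p) = LinearMap.ker (rigidityForm G p) :=
    le_antisymm (hle p) fun u hu =>
      mem_range_trivialMotion.2 (hp u (rigidityForm_eq_zero_iff.1 (LinearMap.mem_ker.1 hu)))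
  filter_upwards [h1, h2] with m h1 h2
  have e1 := (rigidityForm G m).finrank_range_add_finrank_ker
  have e2 := (rigidityForm G p).finrank_range_add_finrank_ker
  have e3 := congrArg (fun K : Submodule ℝ (V → E3) => Module.finrank ℝ K) hp'
  have e4 := Submodule.eq_of_le_of_finrank_le (hle m) (by omega)
  intro u hu
  rw [← mem_range_trivialMotion, e4]
  exact LinearMap.mem_ker.2 (rigidityForm_eq_zero_iff.2 hu)

theorem eventually_isProperlyCongruent {p : V → E3} (hp : IsInfinitesimallyRigid G p) :
    ∀ᶠ x : (V → E3) × (V → E3) in 𝓝 (p, p), SameEdgeLengths G x.1 x.2 →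
      IsProperlyCongruent x.1 x.2 := by
  have hc : Continuous fun x : (V → E3) × (V → E3) => (2⁻¹ : ℝ) • (x.1 + x.2) := by fun_prop
  have h := eventually_isInfinitesimallyRigid hp
  have e : (2⁻¹ : ℝ) • (p + p) = p := by module
  rw [← e] at h
  filter_upwards [(hc.tendsto (p, p)).eventually h] with x hx hl
  exact hx.isProperlyCongruent hl

/-! ### Independent frameworks -/

/-- A weight orthogonal to the range is a self-stress: by symmetry, both ends of each edge
contribute equally, so the pairing with `u` is the total work of the vertex forces. -/
theorem rigidityForm_surjective {p : V → E3}
    (hp : ∀ ω : V → V → ℝ, IsSelfStress G p ω → ω = 0) :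
    Function.Surjective (rigidityForm G p) := by
  rw [← LinearMap.range_eq_top, ← Submodule.orthogonal_eq_bot_iff, Submodule.eq_bot_iff]
  intro y hy
  have key : ∀ u : V → E3, ∑ i, inner ℝ (∑ j, y.1 (i, j) • (p i - p j)) (u i) = 0 := by
    intro u
    have h := (Submodule.mem_orthogonal' _ _).1 hy _ (LinearMap.mem_range_self _ u)
    have h' : ∑ i, ∑ j, y.1 (i, j) * inner ℝ (p i - p j) (u i - u j) = 0 := by
      rw [Submodule.coe_inner, PiLp.inner_apply, Fintype.sum_prod_type] at h
      rw [← h]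
      refine Finset.sum_congr rfl fun i _ => Finset.sum_congr rfl fun j _ => ?_
      by_cases hij : G.Adj i j
      · rw [rigidityForm_apply_of_adj p u hij]
        simp [mul_comm]
      · simp [y.2.2 i j hij]
    have h1 : ∑ i, ∑ j, y.1 (i, j) * inner ℝ (p i - p j) (u j) =
        - ∑ i, ∑ j, y.1 (i, j) * inner ℝ (p i - p j) (u i) := by
      rw [Finset.sum_comm, ← Finset.sum_neg_distrib]
      refine Finset.sum_congr rfl fun i _ => ?_
      rw [← Finset.sum_neg_distrib]
      refine Finset.sum_congr rfl fun j _ => ?_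
      rw [y.2.1 j i, ← neg_sub (p i), inner_neg_left, mul_neg]
    simp only [inner_sub_right, mul_sub, Finset.sum_sub_distrib] at h'
    simp only [sum_inner, real_inner_smul_left]
    linarith
  -- Testing with the vertex forces themselves shows that they vanish.
  have h0 := key fun i => ∑ j, y.1 (i, j) • (p i - p j)
  rw [Finset.sum_eq_zero_iff_of_nonneg fun i _ => real_inner_self_nonneg] at h0
  have := hp (fun i j => y.1 (i, j)) ⟨y.2.1, y.2.2, fun i =>
    inner_self_eq_zero.1 (h0 i (Finset.mem_univ i))⟩
  refine edgeWeights_ext fun i j _ => ?_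
  exact congrFun (congrFun this i) j

/-- The squared-length map, restricted to an affine slice through `p` along a right inverse of the
rigidity map, is a local homeomorphism. The curve is the preimage of a line in the direction of one
edge. -/
theorem exists_curve_of_surjective [DecidableEq V] {p : V → E3}
    (hp : Function.Surjective (rigidityForm G p)) {a b : V} (hab : G.Adj a b) :
    ∃ (ε : ℝ) (γ : ℝ → V → E3), 0 < ε ∧ γ 0 = p ∧ ContinuousOn γ (Set.Ioo (-ε) ε) ∧
      ∀ t ∈ Set.Ioo (-ε) ε, ∀ i j, G.Adj i j → dist (γ t i) (γ t j) ^ 2 =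
        dist (p i) (p j) ^ 2 + if s(i, j) = s(a, b) then t else 0 := by
  let e := edgeIndicator hab
  let Q : (V → E3) →L[ℝ] (V → E3) →L[ℝ] edgeWeights G := (rigidityForm G).toContinuousBilinearMap
  have hQ : ∀ x y, Q x y = rigidityForm G x y := fun x y => rfl
  obtain ⟨R, hR⟩ := (rigidityForm G p).exists_rightInverse_of_surjective
    (LinearMap.range_eq_top.2 hp)
  have hR' : ∀ y, rigidityForm G p (R y) = y := fun y => LinearMap.congr_fun hR y
  have hsymm : ∀ x y, rigidityForm G x y = rigidityForm G y x := fun x y =>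
    edgeWeights_ext fun i j hij => by
      rw [rigidityForm_apply_of_adj _ _ hij, rigidityForm_apply_of_adj _ _ hij, real_inner_comm]
  -- The factor 1/2 offsets the derivative 2 Q(p, ·) of the quadratic map Q(x, x), so that `φ` has
  -- derivative the identity at 0.
  let R' : edgeWeights G →L[ℝ] (V → E3) := LinearMap.toContinuousLinearMap ((2⁻¹ : ℝ) • R)
  let σ : edgeWeights G → V → E3 := fun y => p + R' y
  let φ : edgeWeights G → edgeWeights G := fun y => Q (σ y) (σ y)
  have hs : HasStrictFDerivAt σ R' 0 := (R'.hasStrictFDerivAt).const_add p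
  have hs0 : σ 0 = p := by simp [σ]
  have hφ : HasStrictFDerivAt φ
      ((ContinuousLinearEquiv.refl ℝ (edgeWeights G) : edgeWeights G →L[ℝ] edgeWeights G)) 0 := by
    have h := (Q.isBoundedBilinearMap.hasStrictFDerivAt (σ 0, σ 0)).comp (0 : edgeWeights G)
      (hs.prodMk hs)
    refine h.congr_fderiv (ContinuousLinearMap.ext fun y => ?_)
    simp [hs0, hQ, R', hsymm _ p, hR']
    module
  have hφ0 : φ 0 = rigidityForm G p p := by simp only [φ, hs0, hQ]
  let P := hφ.toOpenPartialHomeomorph φ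
  have hline : Continuous fun t : ℝ => φ 0 + t • e := by fun_prop
  have hmem : φ 0 + (0 : ℝ) • e ∈ P.target := by
    rw [zero_smul, add_zero]
    exact hφ.image_mem_toOpenPartialHomeomorph_target
  obtain ⟨ε, hε, hball⟩ := Metric.isOpen_iff.1 (P.open_target.preimage hline) 0 hmem
  rw [Real.ball_eq_Ioo, zero_sub, zero_add] at hball
  refine ⟨ε, fun t => σ (P.symm (φ 0 + t • e)), hε, ?_, ?_, ?_⟩
  · have : P.symm (φ 0) = 0 := P.left_inv hφ.mem_toOpenPartialHomeomorph_source
    simp only [zero_smul, add_zero, this, hs0]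
  · have hsc : Continuous σ := by fun_prop
    exact hsc.comp_continuousOn (P.continuousOn_symm.comp hline.continuousOn hball)
  · intro t ht i j hij
    have h : φ (P.symm (φ 0 + t • e)) = φ 0 + t • e := P.right_inv (hball ht)
    have h' := congrArg (fun y : edgeWeights G => y.1 (i, j)) h
    simp only [hφ0] at h' ⊢
    simp only [φ, hQ, Submodule.coe_add, Submodule.coe_smul, PiLp.add_apply, PiLp.smul_apply, e,
      edgeIndicator_apply,
      smul_eq_mul, mul_ite, mul_one, mul_zero, rigidityForm_apply_of_adj _ _ hij,
      real_inner_self_eq_norm_sq] at h'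
    simpa only [dist_eq_norm] using h'

end Rigidity

/-! ### The edges of the cap and of the twinned polyhedron -/

section Combinatorics

variable {V : Type*} {F : Finset (Finset V)} {A B A' B' : V}

theorem edgeGraph_image {W : Type*} [DecidableEq W] (F : Finset (Finset V)) {f : V → W}
    (hf : Function.Injective f) {x y : W} :
    (edgeGraph (F.image fun s => s.image f)).Adj x y ↔
      ∃ u v, (edgeGraph F).Adj u v ∧ f u = x ∧ f v = y := by
  simp only [edgeGraph, Finset.mem_image, exists_exists_and_eq_and]
  constructor
  · rintro ⟨hxy, s, hs, ⟨u, hu, rfl⟩, v, hv, rfl⟩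
    exact ⟨u, v, ⟨fun h => hxy (congrArg f h), s, hs, hu, hv⟩, rfl, rfl⟩
  · rintro ⟨u, v, ⟨huv, s, hs, hu, hv⟩, rfl, rfl⟩
    exact ⟨hf.ne huv, s, hs, ⟨u, hu, rfl⟩, v, hv, rfl⟩

theorem edgeGraph_union [DecidableEq V] (F F' : Finset (Finset V)) :
    edgeGraph (F ∪ F') = edgeGraph F ⊔ edgeGraph F' := by
  ext x y
  simp only [edgeGraph, Finset.mem_union, SimpleGraph.sup_adj]
  constructor
  · rintro ⟨h, f, hf | hf, h'⟩
    · exact Or.inl ⟨h, f, hf, h'⟩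
    · exact Or.inr ⟨h, f, hf, h'⟩
  · rintro (⟨h, f, hf, h'⟩ | ⟨h, f, hf, h'⟩)
    · exact ⟨h, f, Or.inl hf, h'⟩
    · exact ⟨h, f, Or.inr hf, h'⟩

variable [DecidableEq V]

theorem firstCopy_injective : Function.Injective (firstCopy A B A' B') := Sum.inl_injective

theorem secondCopy_injective : Function.Injective (secondCopy A B A' B') := by
  intro u v h
  unfold secondCopy at h
  split_ifs at h with hu hv hv
  · exact (Equiv.swap B B').injective ((Equiv.swap A A').injective (Sum.inl_injective h))
  · simpa using h

theorem sameEdgeLengths_twin_iff {P Q : TwinVertex A B A' B' → E3} :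
    SameEdgeLengths (edgeGraph (twinFaces F A B A' B')) P Q ↔
      SameEdgeLengths (edgeGraph (capFaces F A B A' B')) (P ∘ firstCopy A B A' B')
          (Q ∘ firstCopy A B A' B') ∧
        SameEdgeLengths (edgeGraph (capFaces F A B A' B')) (P ∘ secondCopy A B A' B')
          (Q ∘ secondCopy A B A' B') := by
  have key : ∀ x y, (edgeGraph (twinFaces F A B A' B')).Adj x y ↔
      (∃ u v, (edgeGraph (capFaces F A B A' B')).Adj u v ∧ firstCopy A B A' B' u = x ∧
        firstCopy A B A' B' v = y) ∨
      ∃ u v, (edgeGraph (capFaces F A B A' B')).Adj u v ∧ secondCopy A B A' B' u = x ∧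
        secondCopy A B A' B' v = y := fun x y => by
    rw [twinFaces, edgeGraph_union, SimpleGraph.sup_adj, edgeGraph_image _ firstCopy_injective,
      edgeGraph_image _ secondCopy_injective]
  constructor
  · exact fun h => ⟨fun u v huv => h _ _ ((key _ _).2 (Or.inl ⟨u, v, huv, rfl, rfl⟩)),
      fun u v huv => h _ _ ((key _ _).2 (Or.inr ⟨u, v, huv, rfl, rfl⟩))⟩
  · rintro ⟨h1, h2⟩ x y hxy
    rcases (key x y).1 hxy with ⟨u, v, huv, rfl, rfl⟩ | ⟨u, v, huv, rfl, rfl⟩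
    · exact h1 u v huv
    · exact h2 u v huv

/-- Removing the two faces at the edge `A A'` removes exactly this edge. -/
theorem edgeGraph_capFaces_adj [Fintype V] (hF : IsTriangulatedSphere F) (hB : B ≠ B')
    (hBA : B ≠ A) (hBA' : B ≠ A') (hB'A : B' ≠ A) (hB'A' : B' ≠ A') (hA : A ≠ A')
    (hface : ({A, B, A'} : Finset V) ∈ F) (hface' : ({A, A', B'} : Finset V) ∈ F) {u v : V} :
    (edgeGraph (capFaces F A B A' B')).Adj u v ↔
      (edgeGraph F).Adj u v ∧ s(u, v) ≠ s(A, A') := by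
  have hne : ({A, B, A'} : Finset V) ≠ {A, A', B'} := fun h => by
    have : B ∈ ({A, A', B'} : Finset V) := h ▸ by simp
    simp [hB, hBA, hBA'] at this
  constructor
  · rintro ⟨huv, f, hf, hu, hv⟩
    rw [capFaces, Finset.mem_sdiff] at hf
    refine ⟨⟨huv, f, hf.1, hu, hv⟩, fun h => hf.2 ?_⟩
    have hAf : A ∈ f ∧ A' ∈ f := by
      rcases Sym2.eq_iff.1 h with ⟨rfl, rfl⟩ | ⟨rfl, rfl⟩
      · exact ⟨hu, hv⟩
      · exact ⟨hv, hu⟩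
    -- An edge lies on two faces only, so the removed faces are all those containing `A A'`.
    have hsub : ({{A, B, A'}, {A, A', B'}} : Finset (Finset V)) ⊆
        {f ∈ F | A ∈ f ∧ A' ∈ f} := by
      intro g hg
      rw [Finset.mem_insert, Finset.mem_singleton] at hg
      rcases hg with rfl | rfl
      · simp [hface]
      · simp [hface']
    have heq := Finset.eq_of_subset_of_card_le hsub (by
      rw [hF.two_faces A A' ⟨hA, _, hface, by simp, by simp⟩, Finset.card_pair hne])
    rw [heq]
    simp [hf.1, hAf]
  · rintro ⟨⟨huv, hf⟩, hs⟩
    by_contra hcon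
    -- If an edge disappears, both its faces were removed, so its ends lie in both triangles, whose
    -- common vertices are `A` and `A'`.
    have hsub : {f ∈ F | u ∈ f ∧ v ∈ f} ⊆ ({{A, B, A'}, {A, A', B'}} : Finset (Finset V)) := by
      intro g hg
      rw [Finset.mem_filter] at hg
      by_contra hg'
      exact hcon ⟨huv, g, Finset.mem_sdiff.2 ⟨hg.1, hg'⟩, hg.2⟩
    have heq := Finset.eq_of_subset_of_card_le hsub (by
      rw [hF.two_faces u v ⟨huv, hf⟩, Finset.card_pair hne])
    have h1 : ({A, B, A'} : Finset V) ∈ {f ∈ F | u ∈ f ∧ v ∈ f} := by rw [heq]; simp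
    have h2 : ({A, A', B'} : Finset V) ∈ {f ∈ F | u ∈ f ∧ v ∈ f} := by rw [heq]; simp
    simp only [Finset.mem_filter, Finset.mem_insert, Finset.mem_singleton] at h1 h2
    apply hs
    rw [Sym2.eq_iff]
    grind

theorem ne_of_card_triple {a b c : V} (h : ({a, b, c} : Finset V).card = 3) :
    a ≠ b ∧ a ≠ c ∧ b ≠ c := by
  refine ⟨?_, ?_, ?_⟩ <;> rintro rfl
  · rw [Finset.insert_eq_of_mem (by simp)] at h
    exact absurd h (Finset.card_le_two.trans_lt (by norm_num)).ne
  · rw [Finset.insert_eq_of_mem (by simp)] at h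
    exact absurd h (Finset.card_le_two.trans_lt (by norm_num)).ne
  · rw [Finset.pair_eq_singleton] at h
    exact absurd h (Finset.card_le_two.trans_lt (by norm_num)).ne

end Combinatorics

/-! ### The flex of the twinned polyhedron -/

section Flex

variable {V : Type*} [DecidableEq V] {F : Finset (Finset V)} {A B A' B' : V}

theorem secondCopy_equator (hAA' : A ≠ A') (hBB' : B ≠ B') (hAB : A ≠ B) (hAB' : A ≠ B')
    (hA'B : A' ≠ B) (hA'B' : A' ≠ B') :
    secondCopy A B A' B' A = Sum.inl A' ∧ secondCopy A B A' B' B = Sum.inl B' ∧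
      secondCopy A B A' B' A' = Sum.inl A ∧ secondCopy A B A' B' B' = Sum.inl B := by
  refine ⟨?_, ?_, ?_, ?_⟩ <;>
    simp [secondCopy, Equiv.swap_apply_of_ne_of_ne, *, hAA'.symm, hBB'.symm, hAB.symm,
      hAB'.symm, hA'B.symm, hA'B'.symm]

theorem twinPlacement_secondCopy (hAA' : A ≠ A') (hBB' : B ≠ B') (hAB : A ≠ B) (hAB' : A ≠ B')
    (hA'B : A' ≠ B) (hA'B' : A' ≠ B') {p : V → E3} {c d : E3}
    (h : IsSymmetryLine c d (p A) (p B) (p A') (p B')) (v : V) :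
    twinPlacement p A B A' B' c d (secondCopy A B A' B' v) = halfTurn c d (p v) := by
  obtain ⟨h1, h2, h3, h4⟩ := secondCopy_equator hAA' hBB' hAB hAB' hA'B hA'B'
  by_cases hv : v ∈ ({A, B, A', B'} : Finset V)
  · simp only [Finset.mem_insert, Finset.mem_singleton] at hv
    rcases hv with rfl | rfl | rfl | rfl
    · rw [h1, h.swap_a]; rfl
    · rw [h2, h.swap_b]; rfl
    · rw [h3, h.swap_a']; rfl
    · rw [h4, h.swap_b']; rfl
  · rw [secondCopy, dif_neg hv]
    rfl

/-- If the cap has a one-parameter family of placements which is parametrized by the squared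
distance of `A` and `A'`, and exhausts the placements close to `p` up to rigid motions, then the
twinned cap has a single flex. -/
theorem hasSingleFlex_of_curve [Fintype V] {p : V → E3} (hAA' : A ≠ A') (hBB' : B ≠ B')
    (hAB : A ≠ B) (hAB' : A ≠ B') (hA'B : A' ≠ B) (hA'B' : A' ≠ B') {G : SimpleGraph V}
    (hG : ∀ u v, G.Adj u v → s(u, v) ≠ s(A, A') → (edgeGraph (capFaces F A B A' B')).Adj u v)
    (hrigid : ∀ᶠ x : (V → E3) × (V → E3) in 𝓝 (p, p), SameEdgeLengths G x.1 x.2 →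
      IsProperlyCongruent x.1 x.2)
    (hcap : ∀ q : V → E3, SameEdgeLengths (edgeGraph (capFaces F A B A' B')) p q →
      dist (q A) (q B) = dist (q A') (q B') ∧ dist (q A) (q B') = dist (q B) (q A'))
    (hne : cross (p B - p A) (p A' - p A) ≠ 0)
    {ε₀ : ℝ} {γ₀ : ℝ → V → E3} (hε₀ : 0 < ε₀) (hγ₀ : γ₀ 0 = p)
    (hcont : ContinuousOn γ₀ (Set.Ioo (-ε₀) ε₀))
    (hlen : ∀ t ∈ Set.Ioo (-ε₀) ε₀,
      SameEdgeLengths (edgeGraph (capFaces F A B A' B')) p (γ₀ t))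
    (hlen' : ∀ t ∈ Set.Ioo (-ε₀) ε₀,
      dist (γ₀ t A) (γ₀ t A') ^ 2 = dist (p A) (p A') ^ 2 + t)
    {c d : E3} (hcd : IsSymmetryLine c d (p A) (p B) (p A') (p B')) :
    HasSingleFlex (edgeGraph (twinFaces F A B A' B')) (twinPlacement p A B A' B' c d) := by
  obtain ⟨s1, s2, s3, s4⟩ := secondCopy_equator hAA' hBB' hAB hAB' hA'B hA'B'
  obtain ⟨D, hD, hD0, hDs⟩ := exists_continuous_symmetryLine hne (b₀' := p B')
  obtain ⟨hp1, hp2⟩ := hcap p fun _ _ _ => rfl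
  have hat : ContinuousAt γ₀ 0 := hcont.continuousAt (Ioo_mem_nhds (by linarith) hε₀)
  have hv : ∀ v, ContinuousAt (fun t => γ₀ t v) 0 := fun v =>
    (continuous_apply v).continuousAt.comp hat
  let DD : ℝ → E3 := fun t => D (γ₀ t A) (γ₀ t B) (γ₀ t A') (γ₀ t B')
  let CC : ℝ → E3 := fun t => (2⁻¹ : ℝ) • (γ₀ t A + γ₀ t A')
  have hquad : Continuous fun q : V → E3 => (q A, q B, q A', q B') := by fun_prop
  have hDq : Continuous fun q : V → E3 => D (q A) (q B) (q A') (q B') := hD.comp hquad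
  have hDD : ContinuousOn DD (Set.Ioo (-ε₀) ε₀) := hDq.comp_continuousOn hcont
  have hcr : Continuous fun q : V → E3 => cross (q B - q A) (q A' - q A) :=
    continuous_cross (by fun_prop) (by fun_prop)
  have hev : ∀ᶠ t in 𝓝 (0 : ℝ), DD t ≠ 0 ∧ cross (γ₀ t B - γ₀ t A) (γ₀ t A' - γ₀ t A) ≠ 0 := by
    refine (ContinuousAt.eventually_ne (hDq.continuousAt.comp hat) ?_).and
      (ContinuousAt.eventually_ne (hcr.continuousAt.comp hat) ?_)
    · simp only [Function.comp_apply, hγ₀]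
      exact hD0 hp1 hp2
    · simpa only [Function.comp_apply, hγ₀]
  obtain ⟨ε₁, hε₁, hball⟩ := Metric.eventually_nhds_iff_ball.1 hev
  rw [Real.ball_eq_Ioo, zero_sub, zero_add] at hball
  obtain ⟨ε, hε, hεε₀, hεε₁⟩ : ∃ ε, 0 < ε ∧ ε ≤ ε₀ ∧ ε ≤ ε₁ :=
    ⟨min ε₀ ε₁, lt_min hε₀ hε₁, min_le_left _ _, min_le_right _ _⟩
  have hsub : Set.Ioo (-ε) ε ⊆ Set.Ioo (-ε₀) ε₀ := Set.Ioo_subset_Ioo (by linarith) hεε₀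
  have hsub' : Set.Ioo (-ε) ε ⊆ Set.Ioo (-ε₁) ε₁ := Set.Ioo_subset_Ioo (by linarith) hεε₁
  have hsym : ∀ t ∈ Set.Ioo (-ε) ε,
      IsSymmetryLine (CC t) (DD t) (γ₀ t A) (γ₀ t B) (γ₀ t A') (γ₀ t B') := fun t ht => by
    obtain ⟨h1, h2⟩ := hcap _ (hlen t (hsub ht))
    exact hDs _ _ _ _ h1 h2 (hball t (hsub' ht)).1
  have h0 : (0 : ℝ) ∈ Set.Ioo (-ε) ε := ⟨by linarith, hε⟩
  have hsecond : ∀ t ∈ Set.Ioo (-ε) ε,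
      twinPlacement (γ₀ t) A B A' B' (CC t) (DD t) ∘ secondCopy A B A' B' =
        fun v => halfTurn (CC t) (DD t) (γ₀ t v) := fun t ht =>
    funext fun v => twinPlacement_secondCopy hAA' hBB' hAB hAB' hA'B hA'B' (hsym t ht) v
  have hsecond0 : twinPlacement p A B A' B' c d ∘ secondCopy A B A' B' =
      fun v => halfTurn c d (p v) :=
    funext fun v => twinPlacement_secondCopy hAA' hBB' hAB hAB' hA'B hA'B' hcd v
  refine ⟨ε, fun t => twinPlacement (γ₀ t) A B A' B' (CC t) (DD t), hε, ?_, ?_, ?_, ?_, ?_⟩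
  · have hs0 := hsym 0 h0
    rw [hγ₀] at hs0
    have := halfTurn_eq_of_isSymmetryLine hs0 hcd hne
    simp only [twinPlacement, hγ₀, this]
  · refine continuousOn_pi.2 fun x => ?_
    have hvo : ∀ v, ContinuousOn (fun t => γ₀ t v) (Set.Ioo (-ε) ε) := fun v =>
      (continuous_apply v).comp_continuousOn (hcont.mono hsub)
    rcases x with v | v
    · exact hvo v
    · have hCC : ContinuousOn CC (Set.Ioo (-ε) ε) :=
        ((hvo A).add (hvo A')).const_smul (2⁻¹ : ℝ)
      have hDD' : ContinuousOn DD (Set.Ioo (-ε) ε) := hDD.mono hsub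
      simp only [twinPlacement, Sum.elim_inr, halfTurn_apply]
      have hfrac : ContinuousOn (fun t => inner ℝ (DD t) (γ₀ t v - CC t) / ‖DD t‖ ^ 2)
          (Set.Ioo (-ε) ε) :=
        (hDD'.inner ((hvo v).sub hCC)).div (hDD'.norm.pow 2) fun t ht => by
          simpa using (hball t (hsub' ht)).1
      exact ((hCC.add (hfrac.smul hDD')).const_smul (2 : ℝ)).sub (hvo v)
  · intro t ht
    refine sameEdgeLengths_twin_iff.2 ⟨hlen t (hsub ht), ?_⟩
    rw [hsecond t ht, hsecond0]
    intro u v huv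
    simp only [AffineIsometryEquiv.dist_map]
    exact hlen t (hsub ht) u v huv
  · rintro s hs t ht ⟨g, hg⟩
    -- A congruence preserves the distance of `A` and `A'`, which determines the parameter.
    have h1 := hg (Sum.inl A)
    have h2 := hg (Sum.inl A')
    have h3 := hlen' s (hsub hs)
    have h4 := hlen' t (hsub ht)
    simp only [twinPlacement, Sum.elim_inl] at h1 h2
    rw [h1, h2, AffineIsometryEquiv.dist_map] at h4
    linarith
  · intro δ hδ hδε
    -- The only possible parameter for `q`, read off from its squared distance between `A` and `A'`.
    let Λ : (TwinVertex A B A' B' → E3) → ℝ := fun q =>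
      dist (q (Sum.inl A)) (q (Sum.inl A')) ^ 2 - dist (p A) (p A') ^ 2
    have hΛ : Continuous Λ := by fun_prop
    have hΛ0 : Λ (twinPlacement p A B A' B' c d) = 0 := sub_self _
    have hΛt : Tendsto Λ (𝓝 (twinPlacement p A B A' B' c d)) (𝓝 0) := by
      rw [← hΛ0]; exact hΛ.tendsto _
    have hγt : Tendsto (fun q => γ₀ (Λ q)) (𝓝 (twinPlacement p A B A' B' c d)) (𝓝 p) := by
      have := hat.tendsto
      rw [hγ₀] at this
      exact this.comp hΛt
    have hc1 : Continuous fun q : TwinVertex A B A' B' → E3 => q ∘ firstCopy A B A' B' :=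
      continuous_pi fun v => continuous_apply _
    have hc2 : Continuous fun q : TwinVertex A B A' B' → E3 =>
        fun v => halfTurn c d (q (secondCopy A B A' B' v)) :=
      continuous_pi fun v => (halfTurn c d).continuous.comp (continuous_apply _)
    have ht1 : Tendsto (fun q : TwinVertex A B A' B' → E3 => q ∘ firstCopy A B A' B')
        (𝓝 (twinPlacement p A B A' B' c d)) (𝓝 p) := hc1.tendsto _
    have ht2 : Tendsto (fun q : TwinVertex A B A' B' → E3 =>
        fun v => halfTurn c d (q (secondCopy A B A' B' v)))
        (𝓝 (twinPlacement p A B A' B' c d)) (𝓝 p) := by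
      have h := hc2.tendsto (twinPlacement p A B A' B' c d)
      have e : (fun v => halfTurn c d (twinPlacement p A B A' B' c d (secondCopy A B A' B' v))) =
          p := funext fun v => by
        rw [twinPlacement_secondCopy hAA' hBB' hAB hAB' hA'B hA'B' hcd, halfTurn_halfTurn]
      rwa [e] at h
    have hr1 := (hγt.prodMk_nhds ht1).eventually hrigid
    have hr2 := (hγt.prodMk_nhds ht2).eventually hrigid
    filter_upwards [hr1, hr2, hΛt.eventually (Ioo_mem_nhds (neg_lt_zero.2 hδ) hδ)] with
      q hq1 hq2 hqΛ hq
    obtain ⟨hl1, hl2⟩ := sameEdgeLengths_twin_iff.1 hq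
    have ht : Λ q ∈ Set.Ioo (-ε) ε := ⟨by linarith [hqΛ.1], by linarith [hqΛ.2]⟩
    have hall : ∀ r : V → E3, SameEdgeLengths (edgeGraph (capFaces F A B A' B')) p r →
        dist (r A) (r A') = dist (q (Sum.inl A)) (q (Sum.inl A')) →
        SameEdgeLengths G (γ₀ (Λ q)) r := by
      intro r hr hrA u v huv
      by_cases hs : s(u, v) = s(A, A')
      · have hd : dist (r A) (r A') = dist (γ₀ (Λ q) A) (γ₀ (Λ q) A') := by
          rw [← sq_eq_sq₀ dist_nonneg dist_nonneg, hlen' _ (hsub ht), hrA]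
          simp only [Λ]; ring
        rcases Sym2.eq_iff.1 hs with ⟨rfl, rfl⟩ | ⟨rfl, rfl⟩
        · exact hd
        · rw [dist_comm, hd, dist_comm]
      · rw [hr u v (hG u v huv hs), hlen _ (hsub ht) u v (hG u v huv hs)]
    obtain ⟨g₁, hg₁, hg₁'⟩ := hq1 (hall _ hl1 rfl)
    obtain ⟨g₂, hg₂, hg₂'⟩ := hq2 (hall _ (fun u v huv => by
      have h := hl2 u v huv
      rw [hsecond0] at h
      simp only [Function.comp_apply, AffineIsometryEquiv.dist_map] at h ⊢
      -- The second copy interchanges `A` and `A'`, so both copies have the same distance between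
      -- them.
      exact h) (by
        simp only [AffineIsometryEquiv.dist_map]
        rw [s1, s3, dist_comm]))
    have hS := hsym _ ht
    have hg₂'' : ∀ v, q (secondCopy A B A' B' v) = halfTurn c d (g₂ (γ₀ (Λ q) v)) := fun v => by
      rw [← hg₂', halfTurn_halfTurn]
    have hg₁'' : ∀ v, q (Sum.inl v) = g₁ (γ₀ (Λ q) v) := hg₁'
    have heq : (halfTurn (CC (Λ q)) (DD (Λ q))).trans g₁ = g₂.trans (halfTurn c d) := by
      refine IsProper.eq_of_apply_eq ((isProper_halfTurn hS.direction_ne_zero).trans hg₁)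
        (IsProper.trans hg₂ (isProper_halfTurn hcd.direction_ne_zero))
        (hball _ (hsub' ht)).2 ?_ ?_ ?_
      · change g₁ (halfTurn _ _ _) = halfTurn c d (g₂ _)
        rw [hS.swap_a, ← hg₁'', ← hg₂'', s1]
      · change g₁ (halfTurn _ _ _) = halfTurn c d (g₂ _)
        rw [hS.swap_b, ← hg₁'', ← hg₂'', s2]
      · change g₁ (halfTurn _ _ _) = halfTurn c d (g₂ _)
        rw [hS.swap_a', ← hg₁'', ← hg₂'', s3]
    refine ⟨Λ q, hqΛ, g₁, hg₁, ?_⟩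
    rintro (v | v)
    · exact hg₁'' v
    · have h := hg₂'' v.1
      rw [secondCopy, dif_neg v.2] at h
      rw [h]
      exact (congrArg (fun g : E3 ≃ᵃⁱ[ℝ] E3 => g (γ₀ (Λ q) v.1)) heq).symm

end Flex

end

theorem mainTheorem1 {V : Type*} [Fintype V] [DecidableEq V]
    (F : Finset (Finset V)) (p : V → E3)
    (hF : IsTriangulatedSphere F) (hP : IsIsostatic (edgeGraph F) p)
    (A B A' B' : V) (hB : B ≠ B')
    (hface : ({A, B, A'} : Finset V) ∈ F) (hface' : ({A, A', B'} : Finset V) ∈ F)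
    (hAB : dist (p A) (p B) = dist (p A') (p B'))
    (hAB' : dist (p A) (p B') = dist (p B) (p A')) :
    (∃ c d : E3, IsSymmetryLine c d (p A) (p B) (p A') (p B')) ∧
      ∀ c d : E3, IsSymmetryLine c d (p A) (p B) (p A') (p B') →
        HasSingleFlex (edgeGraph (twinFaces F A B A' B')) (twinPlacement p A B A' B' c d) := by
  obtain ⟨nAB, nAA', nBA'⟩ := ne_of_card_triple (hF.card_face _ hface)
  obtain ⟨-, nAB', nA'B'⟩ := ne_of_card_triple (hF.card_face _ hface')
  have aAB : (edgeGraph F).Adj A B := ⟨nAB, _, hface, by simp, by simp⟩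
  have aAA' : (edgeGraph F).Adj A A' := ⟨nAA', _, hface, by simp, by simp⟩
  have aBA' : (edgeGraph F).Adj B A' := ⟨nBA', _, hface, by simp, by simp⟩
  have aAB' : (edgeGraph F).Adj A B' := ⟨nAB', _, hface', by simp, by simp⟩
  have aA'B' : (edgeGraph F).Adj A' B' := ⟨nA'B', _, hface', by simp, by simp⟩
  have hsurj := rigidityForm_surjective hP.independent
  have hne := cross_ne_zero_of_surjective hsurj aAB aAA' aBA'
  have hcapAdj := fun u v => edgeGraph_capFaces_adj hF hB nAB.symm nBA' nAB'.symm nA'B'.symm nAA'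
    hface hface' (u := u) (v := v)
  refine ⟨?_, fun c d hcd => ?_⟩
  · obtain ⟨D, -, hD0, hDs⟩ := exists_continuous_symmetryLine hne (b₀' := p B')
    exact ⟨_, _, hDs _ _ _ _ hAB hAB' (hD0 hAB hAB')⟩
  · obtain ⟨ε, γ, hε, hγ0, hcont, hγ⟩ := exists_curve_of_surjective hsurj aAA'
    refine hasSingleFlex_of_curve nAA' hB nAB nAB' nBA'.symm nA'B'
      (fun u v h h' => (hcapAdj u v).2 ⟨h, h'⟩)
      (eventually_isProperlyCongruent hP.rigid) (fun q hq => ?_) hne hε hγ0 hcont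
      (fun t ht u v huv => ?_) (fun t ht => ?_) hcd
    · rw [hq A B ((hcapAdj A B).2 ⟨aAB, by simp [nBA', nAA']⟩),
        hq A' B' ((hcapAdj A' B').2 ⟨aA'B', by simp [nAA'.symm, nAB'.symm]⟩),
        hq A B' ((hcapAdj A B').2 ⟨aAB', by simp [nA'B'.symm, nAA']⟩),
        hq B A' ((hcapAdj B A').2 ⟨aBA', by simp [nAB.symm, nBA']⟩)]
      exact ⟨hAB, hAB'⟩
    · obtain ⟨h1, h2⟩ := (hcapAdj u v).1 huv
      rw [← sq_eq_sq₀ dist_nonneg dist_nonneg, hγ t ht u v h1, if_neg h2, add_zero]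
    · rw [hγ t ht A A' aAA', if_pos rfl]
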